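/- For a finite simple graph $G=(V,E)$, let the VC-dimension of $G$ be the largest $k$ for which there are vertices $a_i$ ($i\in[k]$) and $b_S$ ($S\subseteq[k]$) such that $a_ib_S\in E$ if and only if $i\in S$. For nonempty $X,Y\subseteq V$, let $d_G(X,Y)=|\{(x,y)\in X\times Y: xy\in E\}|/(|X||Y|)$, and call the pair $(X,Y)$ $\epsilon$-homogeneous if $d_G(X,Y)\in[0,\epsilon)\cup(1-\epsilon,1]$. A partition $\mathcal P$ of $V$ into nonempty parts is an equipartition if the sizes of any two parts differ by at most $1$, and it is $\epsilon$-homogeneous for $G$ if at least $(1-\epsilon)|V|^2$ of the ordered pairs $(x,y)\in V^2$ lie in $X\times Y$ for some $\epsilon$-homogeneous pair $(X,Y)\in\mathcal P^2$. **Theorem.** For every integer $k\ge 1$ there is a constant $C=C(k)>0$ such that the following holds for all $\epsilon\in(0,1/4)$. Let $H=(A\cup B,E)$ be a finite bipartite graph with parts $A$ and $B$, with VC-dimension less than $k$, with $|A|=|B|$ and with $|A|+|B|\ge\epsilon^{-1}$. Then there is an equipartition $\mathcal P$ of $A\cup B$ refining $\{A,B\}$ which is $\epsilon$-homogeneous for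 $H$ and satisfies $\epsilon^{-1}\le|\mathcal P|\le C\epsilon^{-(2k+2)}$. -/

import Mathlib

namespace SimpleGraph

/-- There are vertices `a i` (`i ∈ [k]`) and `b S` (`S ⊆ [k]`) such that `a i` is adjacent to `b S`
if and only if `i ∈ S`. -/
def HasShatteredSet {V : Type*} (G : SimpleGraph V) (k : ℕ) : Prop :=
  ∃ (a : Fin k → V) (b : Finset (Fin k) → V), ∀ i S, G.Adj (a i) (b S) ↔ i ∈ S

/-- The VC-dimension of a graph, i.e. the largest `k` such that `G.HasShatteredSet k`. It takes values
in `ℕ∞`, so that no junk value arises for an infinite graph. -/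
noncomputable def vcDimension {V : Type*} (G : SimpleGraph V) : ℕ∞ :=
  ⨆ (k : ℕ) (_ : G.HasShatteredSet k), (k : ℕ∞)

/-- The pair `(X, Y)` is `ε`-homogeneous: its edge density lies in `[0, ε) ∪ (1 - ε, 1]`. -/
def IsHomogeneousPair {V : Type*} (G : SimpleGraph V) [DecidableRel G.Adj] (ε : ℝ)
    (X Y : Finset V) : Prop :=
  (G.edgeDensity X Y : ℝ) ∈ Set.Ico 0 ε ∪ Set.Ioc (1 - ε) 1

/-- The partition `P` of the vertex set is `ε`-homogeneous: at least `(1 - ε)|V|²` of the ordered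
pairs `(x, y)` of vertices lie in `X × Y` for some `ε`-homogeneous pair `(X, Y)` of parts. -/
def IsHomogeneousPartition {V : Type*} [Fintype V] [DecidableEq V] (G : SimpleGraph V)
    [DecidableRel G.Adj] (ε : ℝ) (P : Finpartition (Finset.univ : Finset V)) : Prop :=
  (1 - ε) * (Fintype.card V : ℝ) ^ 2 ≤
    (Set.ncard {p : V × V | ∃ X ∈ P.parts, ∃ Y ∈ P.parts,
      G.IsHomogeneousPair ε X Y ∧ p.1 ∈ X ∧ p.2 ∈ Y} : ℝ)

end SimpleGraph

/-!
Among vertices whose neighborhoods within `B` pairwise differ in at least `δ * #B` vertices, a set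
`T ⊆ B` of logarithmic size already distinguishes all neighborhoods, so by Sauer–Shelah there are at
most `O(δ⁻¹) ^ k` of them. Hence each given part splits into that many clusters of vertices with
almost equal neighborhoods. Cutting the clusters into `O(δ⁻¹) ^ (k + 1)` pieces of equal size leaves
few vertices over, so on average two vertices of the same piece have close neighborhoods. A
pair of pieces that is not `ε`-homogeneous contributes to this average in proportion to `ε`; with
`δ` of order `ε ^ 2` such pairs cover at most `ε * |V| ^ 2` pairs of vertices.
-/

open Finset SimpleGraph

namespace VCRegularity

/-- Greedily chosen elements of `B` each dispose of a proportion `c` of what is left of `U`. -/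
theorem exists_subset_card_filter_forall_not_le {α β : Type*} (r : α → β → Prop)
    [∀ p y, Decidable (r p y)] (U : Finset α) {B : Finset β} (hB : B.Nonempty) {c : ℝ} (hc : c ≤ 1)
    (h : ∀ p ∈ U, c * #B ≤ #{y ∈ B | r p y}) (m : ℕ) :
    ∃ T ⊆ B, #T ≤ m ∧ (#{p ∈ U | ∀ y ∈ T, ¬ r p y} : ℝ) ≤ (1 - c) ^ m * #U := by
  classical
  induction m with
  | zero => exact ⟨∅, by simp⟩
  | succ m ih =>
    obtain ⟨T, hTB, hTm, hT⟩ := ih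
    set W := {p ∈ U | ∀ y ∈ T, ¬ r p y} with hW
    obtain ⟨y, hy, hyW⟩ : ∃ y ∈ B, c * #W ≤ (#{p ∈ W | r p y} : ℝ) := by
      apply exists_le_of_sum_le hB
      calc ∑ _y ∈ B, c * (#W : ℝ) = ∑ _p ∈ W, c * (#B : ℝ) := by
            simp only [sum_const, nsmul_eq_mul]; ring
        _ ≤ ∑ p ∈ W, (#{y ∈ B | r p y} : ℝ) := sum_le_sum fun p hp => h p (mem_filter.1 hp).1
        _ = ∑ y ∈ B, (#{p ∈ W | r p y} : ℝ) := by
            exact_mod_cast sum_card_bipartiteAbove_eq_sum_card_bipartiteBelow r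
    have hrest : {p ∈ U | ∀ z ∈ insert y T, ¬ r p z} = {p ∈ W | ¬ r p y} := by
      ext p
      simp only [hW, mem_filter, forall_mem_insert]
      tauto
    have hsplit : (#{p ∈ W | r p y} : ℝ) + #{p ∈ W | ¬ r p y} = #W := by
      exact_mod_cast card_filter_add_card_filter_not (s := W) (fun p => r p y)
    refine ⟨insert y T, insert_subset hy hTB, (card_insert_le _ _).trans (by lia), ?_⟩
    calc (#{p ∈ U | ∀ z ∈ insert y T, ¬ r p z} : ℝ) ≤ (1 - c) * #W := by rw [hrest]; linarith
      _ ≤ (1 - c) * ((1 - c) ^ m * #U) := mul_le_mul_of_nonneg_left hT (sub_nonneg.2 hc)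
      _ = (1 - c) ^ (m + 1) * #U := by ring

theorem one_sub_pow_mul_sq_lt_one {N δ : ℝ} {m : ℕ} (hN : 0 < N) (hδ : δ ≤ 1)
    (hm : 2 * Real.log N < δ * m) : (1 - δ) ^ m * N ^ 2 < 1 :=
  calc (1 - δ) ^ m * N ^ 2 ≤ Real.exp (-δ) ^ m * Real.exp (Real.log N) ^ 2 := by
        rw [Real.exp_log hN]
        gcongr
        exact Real.one_sub_le_exp_neg δ
    _ = Real.exp (2 * Real.log N - δ * m) := by
        rw [← Real.exp_nat_mul, ← Real.exp_nat_mul, ← Real.exp_add]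
        push_cast
        ring_nf
    _ < 1 := Real.exp_lt_one_iff.2 (sub_neg.2 hm)

theorem le_pow_of_le_mul_root_pow {j : ℕ} {N w D : ℝ} (hD : 1 ≤ D) (hw : 0 ≤ w)
    (hwN : w ^ ((j + 1) ^ 2) = N) (h : N ≤ (D * w) ^ j) : N ≤ D ^ (j + 1) := by
  by_contra! hlt
  have hDw : D < w ^ (j + 1) := by
    rw [← hwN, sq, pow_mul] at hlt
    exact lt_of_pow_lt_pow_left₀ (j + 1) (by positivity) hlt
  have hw1 : 1 < w := (one_lt_pow_iff_of_nonneg hw j.succ_ne_zero).1 (hD.trans_lt hDw)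
  have : N < N :=
    calc N ≤ (w ^ (j + 1) * w) ^ j := h.trans (by gcongr)
      _ = w ^ ((j + 1 + 1) * j) := by rw [← pow_succ, ← pow_mul]
      _ < w ^ ((j + 1) ^ 2) := pow_lt_pow_right₀ hw1 (by nlinarith)
      _ = N := hwN
  exact this.false

/-- The root `N ^ (1 / k ^ 2)` absorbs the logarithm at the cost of a constant factor only. -/
theorem le_pow_of_le_mul_log_pow {k : ℕ} {N m δ : ℝ} (hN : 1 ≤ N) (hδ : 0 < δ) (hδ1 : δ ≤ 1)
    (hm0 : 0 ≤ m) (hm : m ≤ 2 * Real.log N / δ + 1) (h : N ≤ k * m ^ (k - 1)) :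
    N ≤ (2 * (k + 1) ^ 3 / δ) ^ k := by
  obtain _ | j := k
  · norm_num at h
    linarith
  rw [Nat.add_sub_cancel] at h
  push_cast at h ⊢
  set D : ℝ := 2 * (j + 1 + 1) ^ 3 / δ with hD
  set w := N ^ (((j + 1) ^ 2 : ℕ) : ℝ)⁻¹
  have hw1 : 1 ≤ w := Real.one_le_rpow hN (by positivity)
  have hlog : Real.log N ≤ (j + 1) ^ 2 * w := by
    have := Real.log_le_rpow_div (x := N) (ε := (((j + 1) ^ 2 : ℕ) : ℝ)⁻¹) (by linarith)
      (by positivity)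
    rw [div_inv_eq_mul, mul_comm] at this
    exact_mod_cast this
  have hmw : m ≤ 2 * (j + 1 + 1) ^ 2 * (w / δ) :=
    calc m ≤ 2 * ((j + 1) ^ 2 * w) / δ + w / δ := by
          have : 1 ≤ w / δ := (one_le_div hδ).2 (hδ1.trans hw1)
          exact hm.trans (by gcongr)
      _ = (2 * (j + 1) ^ 2 + 1) * (w / δ) := by ring
      _ ≤ 2 * (j + 1 + 1) ^ 2 * (w / δ) := by
          gcongr
          nlinarith
  have hj : (j + 1 : ℝ) ≤ (j + 1 + 1) ^ j :=
    calc (j + 1 : ℝ) ≤ 2 ^ j := by exact_mod_cast Nat.lt_two_pow_self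
      _ ≤ (j + 1 + 1) ^ j := by gcongr; linarith
  have hND : N ≤ (D * w) ^ j :=
    calc N ≤ (j + 1 + 1) ^ j * (2 * (j + 1 + 1) ^ 2 * (w / δ)) ^ j := h.trans (by gcongr)
      _ = (D * w) ^ j := by rw [← mul_pow, hD]; ring
  have hj1 : (1 : ℝ) ≤ (j + 1 + 1) ^ 3 := one_le_pow₀ (by linarith [j.cast_nonneg (α := ℝ)])
  exact le_pow_of_le_mul_root_pow ((one_le_div hδ).2 (by linarith)) (by linarith)
    (Real.rpow_inv_natCast_pow (by linarith) (by positivity)) hND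

theorem sum_card_parts_equitabilise_not_subset_le {α : Type*} [DecidableEq α] {s : Finset α}
    (P : Finpartition s) {a b m : ℕ} (h : a * m + b * (m + 1) = #s) :
    ∑ X ∈ (P.equitabilise h).parts with ¬∃ u ∈ P.parts, X ⊆ u, #X ≤ #P.parts * m := by
  classical
  set Q := P.equitabilise h
  have hsub : ({X ∈ Q.parts | ¬∃ u ∈ P.parts, X ⊆ u}.biUnion id) ⊆
      P.parts.biUnion fun u => u \ {Y ∈ Q.parts | Y ⊆ u}.biUnion id := by
    intro x hx
    simp only [mem_biUnion, mem_filter, id] at hx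
    obtain ⟨X, ⟨hX, hXu⟩, hxX⟩ := hx
    obtain ⟨u, hu, hxu⟩ := P.exists_mem (Q.subset hX hxX)
    simp only [mem_biUnion, mem_sdiff, mem_filter, id]
    refine ⟨u, hu, hxu, ?_⟩
    rintro ⟨Y, ⟨hY, hYu⟩, hxY⟩
    rw [Q.eq_of_mem_parts hY hX hxY hxX] at hYu
    exact hXu ⟨u, hu, hYu⟩
  calc ∑ X ∈ Q.parts with ¬∃ u ∈ P.parts, X ⊆ u, #X
      = #({X ∈ Q.parts | ¬∃ u ∈ P.parts, X ⊆ u}.biUnion id) :=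
        (card_biUnion fun X hX Y hY hXY =>
          Q.disjoint (mem_filter.1 hX).1 (mem_filter.1 hY).1 hXY).symm
    _ ≤ #(P.parts.biUnion fun u => u \ {Y ∈ Q.parts | Y ⊆ u}.biUnion id) := card_le_card hsub
    _ ≤ #P.parts * m :=
        card_biUnion_le_card_mul _ _ _ fun u hu => P.card_parts_equitabilise_subset_le h hu

theorem exists_finpartition_parts_subset_pair {α : Type*} [DecidableEq α] {s A B : Finset α}
    (hAB : Disjoint A B) (hs : A ∪ B = s) : ∃ P : Finpartition s, P.parts ⊆ {A, B} := by
  have hindep : ({A, B} : Finset (Finset α)).SupIndep id := by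
    rw [supIndep_iff_pairwiseDisjoint, coe_pair]
    exact Set.pairwise_pair.2 fun _ => ⟨hAB, hAB.symm⟩
  exact ⟨.ofErase {A, B} hindep (by simpa using hs), erase_subset _ _⟩

theorem not_hasShatteredSet_of_vcDimension_lt {V : Type*} {G : SimpleGraph V} {k : ℕ}
    (h : G.vcDimension < k) : ¬ G.HasShatteredSet k := fun hs =>
  h.not_ge (le_iSup₂ (f := fun (k : ℕ) (_ : G.HasShatteredSet k) => (k : ℕ∞)) k hs)

section Trace

variable {V : Type*} {G : SimpleGraph V} [DecidableRel G.Adj]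

/-- The trace of the neighborhood of `x` on the vertex set `T`. -/
def nbhdTrace (G : SimpleGraph V) [DecidableRel G.Adj] (T : Finset V) (x : V) : Finset V :=
  {y ∈ T | G.Adj x y}

/-- The distance between the neighborhoods of `x` and `x'` within `B`: the number of vertices in `B`
that are adjacent to exactly one of them. -/
def nbhdDist (G : SimpleGraph V) [DecidableRel G.Adj] (B : Finset V) (x x' : V) : ℕ :=
  #{y ∈ B | ¬(G.Adj x y ↔ G.Adj x' y)}

theorem nbhdDist_self (B : Finset V) (x : V) : nbhdDist G B x x = 0 := by
  simp [nbhdDist]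

theorem nbhdDist_comm (B : Finset V) (x x' : V) : nbhdDist G B x x' = nbhdDist G B x' x := by
  simp [nbhdDist, iff_comm]

theorem nbhdDist_le_card (B : Finset V) (x x' : V) : nbhdDist G B x x' ≤ #B :=
  card_filter_le _ _

theorem nbhdDist_triangle (B : Finset V) (x y z : V) :
    nbhdDist G B x z ≤ nbhdDist G B x y + nbhdDist G B y z := by
  classical
  refine (card_le_card fun w hw => ?_).trans (card_union_le _ _)
  simp only [mem_union, mem_filter] at hw ⊢
  tauto

theorem subset_of_shatters_nbhdTrace [DecidableEq V] {S T s : Finset V}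
    (hs : (S.image (nbhdTrace G T)).Shatters s) : s ⊆ T := by
  obtain ⟨u, hu, hsu⟩ := hs.exists_superset
  obtain ⟨x, -, rfl⟩ := mem_image.1 hu
  exact hsu.trans (filter_subset _ _)

theorem hasShatteredSet_card_of_shatters_nbhdTrace [DecidableEq V] {S T s : Finset V}
    (hs : (S.image (nbhdTrace G T)).Shatters s) : G.HasShatteredSet #s := by
  let e : Fin #s ≃ s := s.equivFin.symm
  have hb : ∀ R : Finset (Fin #s), ∃ x, ∀ i, G.Adj (e i) x ↔ i ∈ R := by
    intro R
    obtain ⟨u, hu, hRu⟩ := hs (image_subset_iff.2 fun i (_ : i ∈ R) => (e i).2)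
    obtain ⟨x, -, rfl⟩ := mem_image.1 hu
    refine ⟨x, fun i => ?_⟩
    have his : (e i : V) ∈ s := (e i).2
    have hiT : (e i : V) ∈ T := subset_of_shatters_nbhdTrace hs his
    have hi := Finset.ext_iff.1 hRu (e i)
    simp only [nbhdTrace, mem_inter, his, mem_filter, hiT, true_and, mem_image, Subtype.val_inj,
      e.injective.eq_iff, exists_eq_right] at hi
    rw [G.adj_comm, hi]
  choose b hb using hb
  exact ⟨fun i => e i, b, fun i R => hb R i⟩

theorem card_le_sum_choose_of_injOn_nbhdTrace {k : ℕ} (hG : ¬ G.HasShatteredSet k) {S T : Finset V}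
    (hinj : Set.InjOn (nbhdTrace G T) (S : Set V)) : #S ≤ ∑ i ∈ range k, (#T).choose i := by
  classical
  have hsub : (S.image (nbhdTrace G T)).shatterer ⊆
      (range k).biUnion fun i => T.powersetCard i := by
    intro s hs
    rw [mem_shatterer] at hs
    suffices #s < k by
      simpa [mem_biUnion, mem_powersetCard] using ⟨this, subset_of_shatters_nbhdTrace hs⟩
    by_contra! hks
    obtain ⟨t, hts, rfl⟩ := exists_subset_card_eq hks
    exact hG (hasShatteredSet_card_of_shatters_nbhdTrace (hs.mono_right hts))
  calc #S = #(S.image (nbhdTrace G T)) := (card_image_of_injOn hinj).symm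
    _ ≤ #(S.image (nbhdTrace G T)).shatterer := card_le_card_shatterer _
    _ ≤ #((range k).biUnion fun i => T.powersetCard i) := card_le_card hsub
    _ ≤ ∑ i ∈ range k, #(T.powersetCard i) := card_biUnion_le
    _ = ∑ i ∈ range k, (#T).choose i := by simp only [card_powersetCard]

theorem sum_range_choose_le_mul_pow {k m : ℕ} (hm : 1 ≤ m) :
    ∑ i ∈ range k, m.choose i ≤ k * m ^ (k - 1) :=
  calc ∑ i ∈ range k, m.choose i ≤ ∑ _i ∈ range k, m ^ (k - 1) := by
        refine sum_le_sum fun i hi => (Nat.choose_le_pow m i).trans (Nat.pow_le_pow_right hm ?_)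
        exact Nat.le_sub_one_of_lt (mem_range.1 hi)
    _ = k * m ^ (k - 1) := by simp

theorem exists_injOn_nbhdTrace {S B : Finset V} (hS : S.Nonempty) (hB : B.Nonempty) {δ : ℝ}
    (hδ : 0 < δ) (hδ1 : δ ≤ 1)
    (hsep : (S : Set V).Pairwise fun x x' => δ * #B ≤ nbhdDist G B x x') :
    ∃ T ⊆ B, #T ≤ ⌊2 * Real.log #S / δ⌋₊ + 1 ∧ Set.InjOn (nbhdTrace G T) (S : Set V) := by
  classical
  set m := ⌊2 * Real.log #S / δ⌋₊ + 1 with hm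
  obtain ⟨T, hTB, hTm, hT⟩ := exists_subset_card_filter_forall_not_le
    (fun (p : V × V) y => ¬(G.Adj p.1 y ↔ G.Adj p.2 y)) S.offDiag hB hδ1
    (fun p hp => by
      rw [mem_offDiag] at hp
      exact hsep hp.1 hp.2.1 hp.2.2) m
  refine ⟨T, hTB, hTm, fun x hx x' hx' hxx' => ?_⟩
  by_contra hne
  have hmem : (x, x') ∈ ({p ∈ S.offDiag | ∀ y ∈ T, ¬¬(G.Adj p.1 y ↔ G.Adj p.2 y)} : Finset _) := by
    refine mem_filter.2 ⟨mem_offDiag.2 ⟨hx, hx', hne⟩, fun y hy => not_not.2 ?_⟩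
    simpa [nbhdTrace, hy] using Finset.ext_iff.1 hxx' y
  have hmlog : 2 * Real.log #S < δ * m := by
    rw [mul_comm δ, ← div_lt_iff₀ hδ, hm]
    exact_mod_cast Nat.lt_floor_add_one _
  have hpairs : (#S.offDiag : ℝ) ≤ #S ^ 2 := by
    rw [offDiag_card, sq]
    exact_mod_cast Nat.sub_le _ _
  have : (1 : ℝ) < 1 :=
    calc (1 : ℝ) ≤ #{p ∈ S.offDiag | ∀ y ∈ T, ¬¬(G.Adj p.1 y ↔ G.Adj p.2 y)} := by
          exact_mod_cast card_pos.2 ⟨_, hmem⟩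
      _ ≤ (1 - δ) ^ m * #S.offDiag := hT
      _ ≤ (1 - δ) ^ m * #S ^ 2 :=
          mul_le_mul_of_nonneg_left hpairs (pow_nonneg (sub_nonneg.2 hδ1) m)
      _ < 1 := one_sub_pow_mul_sq_lt_one (by exact_mod_cast hS.card_pos) hδ1 hmlog
  exact this.false

theorem card_le_of_pairwise_le_nbhdDist {k : ℕ} (hG : ¬ G.HasShatteredSet k) {S B : Finset V}
    (hB : B.Nonempty) {δ : ℝ} (hδ : 0 < δ) (hδ1 : δ ≤ 1)
    (hsep : (S : Set V).Pairwise fun x x' => δ * #B ≤ nbhdDist G B x x') :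
    (#S : ℝ) ≤ (2 * (k + 1) ^ 3 / δ) ^ k := by
  obtain rfl | hS := S.eq_empty_or_nonempty
  · rw [card_empty, Nat.cast_zero]
    positivity
  have hN : (1 : ℝ) ≤ #S := by exact_mod_cast hS.card_pos
  obtain ⟨T, -, hTm, hinj⟩ := exists_injOn_nbhdTrace hS hB hδ hδ1 hsep
  set m := ⌊2 * Real.log #S / δ⌋₊ + 1 with hm
  have hcard : #S ≤ k * m ^ (k - 1) :=
    calc #S ≤ ∑ i ∈ range k, (#T).choose i := card_le_sum_choose_of_injOn_nbhdTrace hG hinj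
      _ ≤ ∑ i ∈ range k, m.choose i := sum_le_sum fun i _ => Nat.choose_le_choose i hTm
      _ ≤ k * m ^ (k - 1) := sum_range_choose_le_mul_pow (Nat.le_add_left 1 _)
  refine le_pow_of_le_mul_log_pow (m := m) hN hδ hδ1 m.cast_nonneg ?_ (by exact_mod_cast hcard)
  rw [hm, Nat.cast_add_one]
  gcongr
  exact Nat.floor_le (div_nonneg (mul_nonneg zero_le_two (Real.log_nonneg hN)) hδ.le)

theorem exists_net_nbhdDist (A B : Finset V) {D : ℝ} (hD : 0 ≤ D) :
    ∃ S : Finset V, S ⊆ A ∧ (S : Set V).Pairwise (fun x x' => D ≤ nbhdDist G B x x') ∧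
      ∀ x ∈ A, ∃ c ∈ S, (nbhdDist G B x c : ℝ) ≤ D := by
  classical
  obtain ⟨S, -, hS⟩ := exists_le_maximal
    ({S ∈ A.powerset | (S : Set V).Pairwise fun x x' => D ≤ nbhdDist G B x x'} :
      Finset (Finset V)) (a := ∅) (by simp)
  obtain ⟨hSA, hsep⟩ := mem_filter.1 hS.prop
  refine ⟨S, mem_powerset.1 hSA, hsep, fun x hx => ?_⟩
  by_contra! hfar
  have hinsert : ((insert x S : Finset V) : Set V).Pairwise fun x x' => D ≤ nbhdDist G B x x' := by
    rw [coe_insert, Set.pairwise_insert]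
    refine ⟨hsep, fun c hc _ => ⟨(hfar c hc).le, ?_⟩⟩
    rw [nbhdDist_comm]
    exact (hfar c hc).le
  have hxS : x ∈ S := hS.le_of_ge
    (mem_filter.2 ⟨mem_powerset.2 (insert_subset hx (mem_powerset.1 hSA)), hinsert⟩)
    (subset_insert x S) (mem_insert_self x S)
  have := hfar x hxS
  rw [nbhdDist_self, Nat.cast_zero] at this
  exact this.not_ge hD

end Trace

section Spread

variable {V : Type*} {G : SimpleGraph V} [DecidableRel G.Adj]

/-- The spread of `X` over `B`: `#X` times the mean distance `nbhdDist G B x x'` of two random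
vertices of `X`. With this normalisation it is additive in `B` and at most `#X * #B`. -/
noncomputable def nbhdSpread (G : SimpleGraph V) [DecidableRel G.Adj] (B X : Finset V) : ℝ :=
  (∑ x ∈ X, ∑ x' ∈ X, (nbhdDist G B x x' : ℝ)) / #X

theorem nbhdSpread_nonneg (B X : Finset V) : 0 ≤ nbhdSpread G B X := by
  unfold nbhdSpread
  positivity

theorem nbhdSpread_le {B X : Finset V} {D : ℝ} (hD : 0 ≤ D)
    (h : ∀ x ∈ X, ∀ x' ∈ X, (nbhdDist G B x x' : ℝ) ≤ D) : nbhdSpread G B X ≤ D * #X := by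
  refine div_le_of_le_mul₀ (by positivity) (by positivity) ?_
  calc ∑ x ∈ X, ∑ x' ∈ X, (nbhdDist G B x x' : ℝ)
      ≤ ∑ _x ∈ X, ∑ _x' ∈ X, D := sum_le_sum fun x hx => sum_le_sum fun x' hx' => h x hx x' hx'
    _ = D * #X * #X := by simp only [sum_const, nsmul_eq_mul]; ring

theorem nbhdSpread_le_card_mul_card (B X : Finset V) : nbhdSpread G B X ≤ #B * #X :=
  nbhdSpread_le (Nat.cast_nonneg _) fun x _ x' _ => by exact_mod_cast nbhdDist_le_card B x x'

theorem nbhdSpread_singleton (B : Finset V) (x : V) : nbhdSpread G B {x} = 0 := by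
  simp [nbhdSpread, nbhdDist_self]

theorem card_mul_nbhdSpread (B X : Finset V) :
    #X * nbhdSpread G B X = ∑ x ∈ X, ∑ x' ∈ X, (nbhdDist G B x x' : ℝ) := by
  obtain rfl | hX := X.eq_empty_or_nonempty
  · simp
  · exact mul_div_cancel₀ _ (by exact_mod_cast hX.card_pos.ne')

variable [DecidableEq V]

theorem sum_nbhdDist_parts {B : Finset V} (Q : Finpartition B) (x x' : V) :
    ∑ Y ∈ Q.parts, nbhdDist G Y x x' = nbhdDist G B x x' := by
  simp only [nbhdDist, card_filter]
  conv_rhs => rw [← Q.biUnion_parts]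
  exact (sum_biUnion Q.disjoint).symm

theorem sum_nbhdSpread_parts {B : Finset V} (Q : Finpartition B) (X : Finset V) :
    ∑ Y ∈ Q.parts, nbhdSpread G Y X = nbhdSpread G B X := by
  simp only [nbhdSpread]
  rw [← sum_div, sum_comm]
  congr 1
  refine sum_congr rfl fun x _ => ?_
  rw [sum_comm]
  refine sum_congr rfl fun x' _ => ?_
  rw [← Nat.cast_sum, sum_nbhdDist_parts]

end Spread

section Cluster

variable {V : Type*} {G : SimpleGraph V} [DecidableRel G.Adj] [DecidableEq V]

theorem exists_finpartition_nbhdDist_le {k : ℕ} (hG : ¬ G.HasShatteredSet k)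
    (A : Finset V) {B : Finset V} (hB : B.Nonempty) {δ : ℝ} (hδ : 0 < δ) (hδ1 : δ ≤ 1) :
    ∃ P : Finpartition A, (#P.parts : ℝ) ≤ (2 * (k + 1) ^ 3 / δ) ^ k ∧
      ∀ u ∈ P.parts, ∀ x ∈ u, ∀ x' ∈ u, (nbhdDist G B x x' : ℝ) ≤ 2 * δ * #B := by
  classical
  obtain ⟨S, -, hS, hnet⟩ := exists_net_nbhdDist (G := G) A B (D := δ * #B) (by positivity)
  have : Nonempty V := hB.nonempty
  choose! c hcS hc using hnet
  refine ⟨Finpartition.ofSetSetoid (Setoid.ker c) A, ?_, fun u hu x hx x' hx' => ?_⟩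
  · have hparts : (Finpartition.ofSetSetoid (Setoid.ker c) A).parts ⊆
        S.image fun s => {b ∈ A | s = c b} := by
      intro u hu
      obtain ⟨a, ha, rfl⟩ := mem_image.1 hu
      exact mem_image.2 ⟨c a, hcS a ha, rfl⟩
    refine le_trans ?_ (card_le_of_pairwise_le_nbhdDist hG hB hδ hδ1 hS)
    exact_mod_cast (card_le_card hparts).trans card_image_le
  · obtain ⟨a, -, rfl⟩ := mem_image.1 hu
    rw [mem_filter] at hx hx'
    have hcc : c x = c x' := hx.2.symm.trans hx'.2
    calc (nbhdDist G B x x' : ℝ) ≤ nbhdDist G B x (c x) + nbhdDist G B x' (c x') := by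
          rw [← hcc, nbhdDist_comm B x']
          exact_mod_cast nbhdDist_triangle B x (c x) x'
      _ ≤ δ * #B + δ * #B := add_le_add (hc x hx.1) (hc x' hx'.1)
      _ = 2 * δ * #B := by ring

theorem sum_nbhdSpread_equitabilise_le {A B : Finset V} (P : Finpartition A) {D : ℝ}
    (hD : 0 ≤ D) (hP : ∀ u ∈ P.parts, ∀ x ∈ u, ∀ x' ∈ u, (nbhdDist G B x x' : ℝ) ≤ D)
    {a b m : ℕ} (h : a * m + b * (m + 1) = #A) :
    ∑ X ∈ (P.equitabilise h).parts, nbhdSpread G B X ≤ D * #A + #P.parts * m * #B := by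
  classical
  set Q := P.equitabilise h
  have hterm : ∀ X ∈ Q.parts, nbhdSpread G B X ≤
      D * #X + if ∃ u ∈ P.parts, X ⊆ u then 0 else (#X : ℝ) * #B := by
    intro X hX
    split_ifs with hXP
    · obtain ⟨u, hu, hXu⟩ := hXP
      rw [add_zero]
      exact nbhdSpread_le hD fun x hx x' hx' => hP u hu x (hXu hx) x' (hXu hx')
    · have hXB := nbhdSpread_le_card_mul_card (G := G) B X
      have : 0 ≤ D * #X := by positivity
      linarith
  calc ∑ X ∈ Q.parts, nbhdSpread G B X
      ≤ ∑ X ∈ Q.parts, (D * #X + if ∃ u ∈ P.parts, X ⊆ u then 0 else (#X : ℝ) * #B) :=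
        sum_le_sum hterm
    _ = D * #A + (∑ X ∈ Q.parts with ¬∃ u ∈ P.parts, X ⊆ u, #X : ℕ) * #B := by
        rw [sum_add_distrib, ← mul_sum, ← Nat.cast_sum, Q.sum_card_parts, sum_ite, sum_const_zero,
          zero_add, ← sum_mul, ← Nat.cast_sum]
    _ ≤ D * #A + (#P.parts * m : ℕ) * #B := by
        gcongr
        exact sum_card_parts_equitabilise_not_subset_le P h
    _ = D * #A + #P.parts * m * #B := by rw [Nat.cast_mul]

theorem exists_isEquipartition_sum_nbhdSpread_le {A B : Finset V} (P : Finpartition A) {D : ℝ}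
    (hD : 0 ≤ D) (hP : ∀ u ∈ P.parts, ∀ x ∈ u, ∀ x' ∈ u, (nbhdDist G B x x' : ℝ) ≤ D)
    {t : ℕ} (ht : 0 < t) (htA : t ≤ #A) :
    ∃ Q : Finpartition A, Q.IsEquipartition ∧ #Q.parts = t ∧
      ∑ X ∈ Q.parts, nbhdSpread G B X ≤ D * #A + #P.parts * (#A / t : ℕ) * #B := by
  have hlt : #A % t < t := Nat.mod_lt _ ht
  have hsum : (t - #A % t) * (#A / t) + #A % t * (#A / t + 1) = #A := by
    rw [tsub_mul, mul_add, ← add_assoc,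
      tsub_add_cancel_of_le (Nat.mul_le_mul_right _ hlt.le), mul_one, add_comm, Nat.mod_add_div]
  refine ⟨P.equitabilise hsum, P.equitabilise_isEquipartition, ?_,
    sum_nbhdSpread_equitabilise_le P hD hP hsum⟩
  rw [P.card_parts_equitabilise hsum (Nat.div_pos htA ht).ne', Nat.sub_add_cancel hlt.le]

theorem exists_isEquipartition_card_eq_min_sum_nbhdSpread_le {k : ℕ} (hG : ¬ G.HasShatteredSet k)
    (A : Finset V) {B : Finset V} (hB : B.Nonempty) {δ : ℝ} (hδ : 0 < δ) (hδ1 : δ ≤ 1) {t : ℕ}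
    (ht : (2 * (k + 1) ^ 3 / δ) ^ k / δ ≤ t) :
    ∃ Q : Finpartition A, Q.IsEquipartition ∧ #Q.parts = min t #A ∧
      ∑ X ∈ Q.parts, nbhdSpread G B X ≤ 3 * δ * #A * #B := by
  obtain hAt | htA := le_total #A t
  · refine ⟨⊥, Finpartition.bot_isEquipartition A, ?_, ?_⟩
    · rw [Finpartition.card_bot, min_eq_right hAt]
    · refine (sum_nonpos fun X hX => ?_).trans (by positivity)
      obtain ⟨x, -, rfl⟩ := Finpartition.mem_bot_iff.1 hX
      exact (nbhdSpread_singleton B x).le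
  · have ht0 : (0 : ℝ) < t := lt_of_lt_of_le (by positivity) ht
    obtain ⟨P, hPcard, hP⟩ := exists_finpartition_nbhdDist_le hG A hB hδ hδ1
    obtain ⟨Q, hQ, hQcard, hsum⟩ := exists_isEquipartition_sum_nbhdSpread_le P (by positivity) hP
      (by exact_mod_cast ht0) htA
    refine ⟨Q, hQ, hQcard.trans (min_eq_left htA).symm, hsum.trans ?_⟩
    have hcut : (#P.parts : ℝ) * (#A / t : ℕ) ≤ δ * #A :=
      calc (#P.parts : ℝ) * (#A / t : ℕ) ≤ (t * δ) * (#A / t) :=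
            mul_le_mul (hPcard.trans ((div_le_iff₀ hδ).1 ht)) Nat.cast_div_le (by positivity)
              (by positivity)
        _ = δ * #A := by field_simp
    calc 2 * δ * #B * #A + #P.parts * (#A / t : ℕ) * #B ≤ 2 * δ * #B * #A + δ * #A * #B := by
          gcongr
      _ = 3 * δ * #A * #B := by ring

theorem exists_le_isEquipartition_sum_nbhdSpread_le {k : ℕ} (hG : ¬ G.HasShatteredSet k)
    {s : Finset V} (P₀ : Finpartition s) {n : ℕ} (hP₀ : ∀ A ∈ P₀.parts, #A = n) {B : Finset V}
    (hB : B.Nonempty) {δ : ℝ} (hδ : 0 < δ) (hδ1 : δ ≤ 1) {t : ℕ}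
    (ht : (2 * (k + 1) ^ 3 / δ) ^ k / δ ≤ t) :
    ∃ P ≤ P₀, P.IsEquipartition ∧ #P.parts = #P₀.parts * min t n ∧
      ∑ X ∈ P.parts, nbhdSpread G B X ≤ 3 * δ * #s * #B := by
  choose Q hQ hQcard hQsum using fun A =>
    exists_isEquipartition_card_eq_min_sum_nbhdSpread_le hG A hB hδ hδ1 ht
  refine ⟨P₀.bind fun A _ => Q A, fun X hX => ?_, ?_, ?_, ?_⟩
  · obtain ⟨A, hA, hX⟩ := Finpartition.mem_bind.1 hX
    exact ⟨A, hA, (Q A).le hX⟩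
  · refine Set.equitableOn_iff_exists_eq_eq_add_one.2 ⟨n / min t n, fun X hX => ?_⟩
    obtain ⟨A, hA, hX⟩ := Finpartition.mem_bind.1 hX
    simpa only [hQcard, hP₀ A hA] using (hQ A).card_parts_eq_average hX
  · rw [Finpartition.card_bind, sum_attach P₀.parts fun A => #(Q A).parts]
    exact sum_const_nat fun A hA => by rw [hQcard, hP₀ A hA]
  · calc ∑ X ∈ (P₀.bind fun A _ => Q A).parts, nbhdSpread G B X
        = ∑ A ∈ P₀.parts, ∑ X ∈ (Q A).parts, nbhdSpread G B X :=
          (Finpartition.sum_combine (fun A : P₀.parts => Q A) P₀.supIndep.attach _).trans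
            (sum_attach P₀.parts fun A => ∑ X ∈ (Q A).parts, nbhdSpread G B X)
      _ ≤ ∑ A ∈ P₀.parts, 3 * δ * #A * #B := sum_le_sum fun A _ => hQsum A
      _ = 3 * δ * #s * #B := by
          rw [← sum_mul, ← mul_sum, ← Nat.cast_sum, P₀.sum_card_parts]

end Cluster

section Homogeneity

variable {V : Type*} {G : SimpleGraph V} [DecidableRel G.Adj]

theorem sum_adjMatrix (X Y : Finset V) :
    ∑ x ∈ X, ∑ y ∈ Y, G.adjMatrix ℝ x y = G.edgeDensity X Y * (#X * #Y) := by
  obtain rfl | hX := X.eq_empty_or_nonempty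
  · simp
  obtain rfl | hY := Y.eq_empty_or_nonempty
  · simp
  have hX0 : (#X : ℝ) ≠ 0 := by exact_mod_cast hX.card_pos.ne'
  have hY0 : (#Y : ℝ) ≠ 0 := by exact_mod_cast hY.card_pos.ne'
  simp only [adjMatrix_apply]
  rw [edgeDensity_def, ← sum_product', interedges_def, card_filter]
  push_cast [apply_ite]
  field_simp

theorem nbhdDist_eq_sum_abs_adjMatrix_sub (Y : Finset V) (x x' : V) :
    (nbhdDist G Y x x' : ℝ) = ∑ y ∈ Y, |G.adjMatrix ℝ x y - G.adjMatrix ℝ x' y| := by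
  rw [nbhdDist, card_filter, Nat.cast_sum]
  refine sum_congr rfl fun y _ => ?_
  by_cases h : G.Adj x y <;> by_cases h' : G.Adj x' y <;> simp [h, h']

theorem sum_abs_adjMatrix_sub (X Y : Finset V) :
    ∑ x ∈ X, ∑ x' ∈ X, ∑ y ∈ Y, ∑ y' ∈ Y, |G.adjMatrix ℝ x y - G.adjMatrix ℝ x' y'| =
      2 * G.edgeDensity X Y * (1 - G.edgeDensity X Y) * (#X * #Y) ^ 2 := by
  have habs : ∀ x x' y y', |G.adjMatrix ℝ x y - G.adjMatrix ℝ x' y'| =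
      G.adjMatrix ℝ x y + G.adjMatrix ℝ x' y' - 2 * (G.adjMatrix ℝ x y * G.adjMatrix ℝ x' y') := by
    intro x x' y y'
    by_cases h : G.Adj x y <;> by_cases h' : G.Adj x' y' <;> norm_num [h, h']
  simp only [habs, sum_add_distrib, sum_sub_distrib, ← mul_sum, ← sum_mul, sum_const,
    nsmul_eq_mul]
  rw [sum_adjMatrix]
  ring

theorem sum_abs_adjMatrix_sub_left (X Y : Finset V) :
    ∑ x ∈ X, ∑ x' ∈ X, ∑ y ∈ Y, ∑ _y' ∈ Y, |G.adjMatrix ℝ x y - G.adjMatrix ℝ x' y| =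
      #X * #Y * nbhdSpread G Y X := by
  rw [mul_right_comm, card_mul_nbhdSpread]
  simp only [nbhdDist_eq_sum_abs_adjMatrix_sub, sum_const, nsmul_eq_mul, ← mul_sum, mul_comm]

theorem sum_abs_adjMatrix_sub_right (X Y : Finset V) :
    ∑ _x ∈ X, ∑ x' ∈ X, ∑ y ∈ Y, ∑ y' ∈ Y, |G.adjMatrix ℝ x' y - G.adjMatrix ℝ x' y'| =
      #X * #Y * nbhdSpread G X Y := by
  rw [mul_assoc, card_mul_nbhdSpread, sum_const, nsmul_eq_mul, sum_comm]
  congr 1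
  refine sum_congr rfl fun y _ => ?_
  rw [sum_comm]
  refine sum_congr rfl fun y' _ => ?_
  rw [nbhdDist_eq_sum_abs_adjMatrix_sub]
  simp only [adjMatrix_apply, G.adj_comm]

/-- Two random pairs `(x, y)` and `(x', y')` of `X × Y` differ in adjacency with probability
`2 d (1 - d)`; in that case `(x', y)` differs from one of them. -/
theorem edgeDensity_mul_one_sub_le_nbhdSpread (X Y : Finset V) :
    2 * G.edgeDensity X Y * (1 - G.edgeDensity X Y) * (#X * #Y) ≤
      nbhdSpread G Y X + nbhdSpread G X Y := by
  obtain h | h := (show (0 : ℝ) ≤ #X * #Y by positivity).eq_or_lt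
  · rw [← h, mul_zero]
    exact add_nonneg (nbhdSpread_nonneg _ _) (nbhdSpread_nonneg _ _)
  refine le_of_mul_le_mul_left ?_ h
  calc (#X * #Y : ℝ) * (2 * G.edgeDensity X Y * (1 - G.edgeDensity X Y) * (#X * #Y))
      = ∑ x ∈ X, ∑ x' ∈ X, ∑ y ∈ Y, ∑ y' ∈ Y, |G.adjMatrix ℝ x y - G.adjMatrix ℝ x' y'| := by
        rw [sum_abs_adjMatrix_sub]
        ring
    _ ≤ ∑ x ∈ X, ∑ x' ∈ X, ∑ y ∈ Y, ∑ y' ∈ Y, (|G.adjMatrix ℝ x y - G.adjMatrix ℝ x' y| +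
          |G.adjMatrix ℝ x' y - G.adjMatrix ℝ x' y'|) := by
        gcongr
        exact abs_sub_le _ _ _
    _ = #X * #Y * (nbhdSpread G Y X + nbhdSpread G X Y) := by
        simp only [sum_add_distrib]
        rw [sum_abs_adjMatrix_sub_left, sum_abs_adjMatrix_sub_right, mul_add]

theorem mul_card_mul_card_le_nbhdSpread {X Y : Finset V} {ε : ℝ}
    (h : ¬ G.IsHomogeneousPair ε X Y) :
    ε * (#X * #Y) ≤ nbhdSpread G Y X + nbhdSpread G X Y := by
  refine le_trans ?_ (edgeDensity_mul_one_sub_le_nbhdSpread X Y)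
  have h0 : (0 : ℝ) ≤ G.edgeDensity X Y := by exact_mod_cast G.edgeDensity_nonneg X Y
  have h1 : (G.edgeDensity X Y : ℝ) ≤ 1 := by exact_mod_cast G.edgeDensity_le_one X Y
  obtain ⟨hε, hε'⟩ : ε ≤ G.edgeDensity X Y ∧ G.edgeDensity X Y ≤ 1 - ε := by
    simpa only [IsHomogeneousPair, Set.mem_union, Set.mem_Ico, Set.mem_Ioc, h0, h1, true_and,
      and_true, not_or, not_lt] using h
  gcongr ?_ * _
  nlinarith

variable [DecidableEq V]

open Classical in
theorem mul_sum_card_mul_card_le_sum_nbhdSpread {s : Finset V} (P : Finpartition s) (ε : ℝ) :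
    ε * ∑ p ∈ P.parts ×ˢ P.parts with ¬ G.IsHomogeneousPair ε p.1 p.2, (#p.1 * #p.2 : ℝ) ≤
      2 * ∑ X ∈ P.parts, nbhdSpread G s X := by
  rw [mul_sum]
  calc ∑ p ∈ P.parts ×ˢ P.parts with ¬ G.IsHomogeneousPair ε p.1 p.2, ε * (#p.1 * #p.2 : ℝ)
      ≤ ∑ p ∈ P.parts ×ˢ P.parts with ¬ G.IsHomogeneousPair ε p.1 p.2,
          (nbhdSpread G p.2 p.1 + nbhdSpread G p.1 p.2) :=
        sum_le_sum fun p hp => mul_card_mul_card_le_nbhdSpread (mem_filter.1 hp).2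
    _ ≤ ∑ p ∈ P.parts ×ˢ P.parts, (nbhdSpread G p.2 p.1 + nbhdSpread G p.1 p.2) :=
        sum_le_sum_of_subset_of_nonneg (filter_subset _ _) fun p _ _ =>
          add_nonneg (nbhdSpread_nonneg _ _) (nbhdSpread_nonneg _ _)
    _ = 2 * ∑ X ∈ P.parts, nbhdSpread G s X := by
        rw [sum_add_distrib, sum_product, sum_product_right]
        simp only [sum_nbhdSpread_parts, two_mul]

open Classical in
theorem isHomogeneousPartition_of_sum_card_mul_card_le [Fintype V]
    {P : Finpartition (univ : Finset V)} {ε : ℝ}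
    (h : ∑ p ∈ P.parts ×ˢ P.parts with ¬ G.IsHomogeneousPair ε p.1 p.2, (#p.1 * #p.2 : ℝ) ≤
      ε * (Fintype.card V : ℝ) ^ 2) : G.IsHomogeneousPartition ε P := by
  unfold IsHomogeneousPartition
  set T : Set (V × V) := {p | ∃ X ∈ P.parts, ∃ Y ∈ P.parts,
    G.IsHomogeneousPair ε X Y ∧ p.1 ∈ X ∧ p.2 ∈ Y}
  set N := {p ∈ P.parts ×ˢ P.parts | ¬ G.IsHomogeneousPair ε p.1 p.2}
  have hsub : Tᶜ ⊆ (N.biUnion fun p => p.1 ×ˢ p.2 : Finset (V × V)) := by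
    rintro ⟨x, y⟩ hxy
    obtain ⟨X, hX, hxX⟩ := P.exists_mem (mem_univ x)
    obtain ⟨Y, hY, hyY⟩ := P.exists_mem (mem_univ y)
    have hXY : ¬ G.IsHomogeneousPair ε X Y := fun hXY => hxy ⟨X, hX, Y, hY, hXY, hxX, hyY⟩
    exact mem_biUnion.2 ⟨(X, Y), mem_filter.2 ⟨mem_product.2 ⟨hX, hY⟩, hXY⟩,
      mem_product.2 ⟨hxX, hyY⟩⟩
  have hcompl : (Tᶜ.ncard : ℝ) ≤ ε * (Fintype.card V : ℝ) ^ 2 :=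
    calc (Tᶜ.ncard : ℝ) ≤ #(N.biUnion fun p => p.1 ×ˢ p.2) := by
          exact_mod_cast (Set.ncard_le_ncard hsub (finite_toSet _)).trans_eq
            (Set.ncard_coe_finset _)
      _ ≤ ∑ p ∈ N, (#p.1 * #p.2 : ℝ) := by
          exact_mod_cast card_biUnion_le.trans_eq (by simp only [card_product])
      _ ≤ ε * (Fintype.card V : ℝ) ^ 2 := h
  have htotal : (T.ncard : ℝ) + Tᶜ.ncard = (Fintype.card V : ℝ) ^ 2 := by
    have := Set.ncard_add_ncard_compl T
    rw [Nat.card_eq_fintype_card, Fintype.card_prod, ← sq] at this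
    exact_mod_cast this
  linarith

theorem isHomogeneousPartition_of_sum_nbhdSpread_le [Fintype V]
    {P : Finpartition (univ : Finset V)} {ε : ℝ} (hε : 0 < ε)
    (h : ∑ X ∈ P.parts, nbhdSpread G univ X ≤ ε ^ 2 / 2 * (Fintype.card V : ℝ) ^ 2) :
    G.IsHomogeneousPartition ε P := by
  refine isHomogeneousPartition_of_sum_card_mul_card_le (le_of_mul_le_mul_left ?_ hε)
  refine (mul_sum_card_mul_card_le_sum_nbhdSpread P ε).trans ?_
  linarith

end Homogeneity

theorem inv_le_div_pow_div (k : ℕ) {ε : ℝ} (hε : 0 < ε) (hε1 : ε ≤ 1) :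
    ε⁻¹ ≤ (2 * (k + 1) ^ 3 / (ε ^ 2 / 6)) ^ k / (ε ^ 2 / 6) := by
  have hδε : ε ^ 2 / 6 ≤ ε := by nlinarith
  have hk : (1 : ℝ) ≤ (k + 1) ^ 3 := one_le_pow₀ (by linarith [k.cast_nonneg (α := ℝ)])
  calc ε⁻¹ ≤ 1 / (ε ^ 2 / 6) := by
        rw [one_div]
        exact inv_anti₀ (by positivity) hδε
    _ ≤ (2 * (k + 1) ^ 3 / (ε ^ 2 / 6)) ^ k / (ε ^ 2 / 6) := by
        gcongr
        exact one_le_pow₀ ((one_le_div (by positivity)).2 (by linarith))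

theorem two_mul_div_pow_div_eq (k : ℕ) (ε : ℝ) :
    2 * ((2 * (k + 1) ^ 3 / (ε ^ 2 / 6)) ^ k / (ε ^ 2 / 6)) =
      12 ^ (k + 1) * (k + 1) ^ (3 * k) * ε⁻¹ ^ (2 * k + 2) :=
  calc 2 * ((2 * (k + 1) ^ 3 / (ε ^ 2 / 6)) ^ k / (ε ^ 2 / 6))
      = 12 * ((12 * (k + 1) ^ 3 * ε⁻¹ ^ 2) ^ k * ε⁻¹ ^ 2) := by
        rw [div_div_eq_mul_div, div_div_eq_mul_div, div_eq_mul_inv _ (ε ^ 2), ← inv_pow,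
          div_eq_mul_inv _ (ε ^ 2), ← inv_pow]
        ring
    _ = 12 ^ (k + 1) * (k + 1) ^ (3 * k) * ε⁻¹ ^ (2 * k + 2) := by
        rw [mul_pow, mul_pow, ← pow_mul, ← pow_mul]
        ring

end VCRegularity

open VCRegularity

theorem theorem2p6_general {V : Type*} [Fintype V] [DecidableEq V] {G : SimpleGraph V}
    [DecidableRel G.Adj] {k : ℕ} (hG : G.vcDimension < k)
    (P₀ : Finpartition (univ : Finset V)) {n : ℕ} (hP₀ : ∀ A ∈ P₀.parts, #A = n) {ε : ℝ}
    (hε : 0 < ε) (hε1 : ε ≤ 1) (hV : ε⁻¹ ≤ Fintype.card V) :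
    ∃ P ≤ P₀, P.IsEquipartition ∧ G.IsHomogeneousPartition ε P ∧ ε⁻¹ ≤ #P.parts ∧
      (#P.parts : ℝ) ≤ 12 ^ (k + 1) * (k + 1) ^ (3 * k) * #P₀.parts * ε⁻¹ ^ (2 * k + 2) := by
  set δ : ℝ := ε ^ 2 / 6 with hδ
  have hδ0 : 0 < δ := by positivity
  have hδ1 : δ ≤ 1 := by nlinarith
  set τ : ℝ := (2 * (k + 1) ^ 3 / δ) ^ k / δ with hτ
  set t := ⌈τ⌉₊
  have hετ : ε⁻¹ ≤ τ := inv_le_div_pow_div k hε hε1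
  have hτ1 : 1 ≤ τ := ((one_le_inv₀ hε).2 hε1).trans hετ
  have hcard : (0 : ℝ) < Fintype.card V := (inv_pos.2 hε).trans_le hV
  have huniv : (univ : Finset V).Nonempty := card_pos.1 (by exact_mod_cast hcard)
  obtain ⟨P, hP, hPeq, hPcard, hPsum⟩ := exists_le_isEquipartition_sum_nbhdSpread_le
    (not_hasShatteredSet_of_vcDimension_lt hG) P₀ hP₀ huniv hδ0 hδ1 (Nat.le_ceil τ)
  have hV' : Fintype.card V = #P₀.parts * n := by
    rw [← card_univ, ← P₀.sum_card_parts, sum_const_nat hP₀]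
  refine ⟨P, hP, hPeq, isHomogeneousPartition_of_sum_nbhdSpread_le hε (hPsum.trans_eq ?_), ?_, ?_⟩
  · rw [card_univ, hδ]
    ring
  · obtain htn | htn := le_total t n
    · have hparts : (1 : ℝ) ≤ #P₀.parts := by
        exact_mod_cast (P₀.parts_nonempty huniv.ne_empty).card_pos
      rw [hPcard, min_eq_left htn, Nat.cast_mul]
      nlinarith [Nat.le_ceil τ]
    · rwa [hPcard, min_eq_right htn, ← hV']
  · calc (#P.parts : ℝ) ≤ #P₀.parts * t := by
          rw [hPcard]
          exact_mod_cast Nat.mul_le_mul_left _ (min_le_left t n)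
      _ ≤ #P₀.parts * (2 * τ) := by
          gcongr
          exact Nat.ceil_le_two_mul (by linarith)
      _ = 12 ^ (k + 1) * (k + 1) ^ (3 * k) * #P₀.parts * ε⁻¹ ^ (2 * k + 2) := by
          rw [hτ, hδ, two_mul_div_pow_div_eq]
          ring

theorem theorem2p6 (k : ℕ) (hk : 1 ≤ k) :
    ∃ C : ℝ, 0 < C ∧ ∀ ε : ℝ, 0 < ε → ε < 1 / 4 →
      ∀ (V : Type*) [Fintype V] [DecidableEq V] (H : SimpleGraph V) [DecidableRel H.Adj]
        (A B : Finset V),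
        A ∪ B = Finset.univ →
        H.IsBipartiteWith (A : Set V) (B : Set V) →
        A.card = B.card →
        H.vcDimension < (k : ℕ∞) →
        ε⁻¹ ≤ (Fintype.card V : ℝ) →
        ∃ P : Finpartition (Finset.univ : Finset V),
          P.IsEquipartition ∧
          (∀ X ∈ P.parts, X ⊆ A ∨ X ⊆ B) ∧
          H.IsHomogeneousPartition ε P ∧
          ε⁻¹ ≤ (P.parts.card : ℝ) ∧
          (P.parts.card : ℝ) ≤ C * ε⁻¹ ^ (2 * k + 2) := by
  refine ⟨2 * (12 ^ (k + 1) * (k + 1) ^ (3 * k)), by positivity, ?_⟩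
  intro ε hε hε4 V _ _ H _ A B hAB hH hcard hvc hV
  obtain ⟨P₀, hP₀⟩ := exists_finpartition_parts_subset_pair (disjoint_coe.1 hH.disjoint) hAB
  have hpart : ∀ X ∈ P₀.parts, X = A ∨ X = B := fun X hX => by simpa using hP₀ hX
  obtain ⟨P, hP, hPeq, hPhom, hPge, hPle⟩ := theorem2p6_general hvc P₀ (n := #A)
    (fun X hX => (hpart X hX).elim (congrArg card) fun h => h ▸ hcard.symm) hε (by linarith) hV
  refine ⟨P, hPeq, fun X hX => ?_, hPhom, hPge, hPle.trans ?_⟩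
  · obtain ⟨Y, hY, hXY⟩ := hP hX
    exact (hpart Y hY).imp hXY.trans_eq hXY.trans_eq
  · rw [mul_comm (2 : ℝ)]
    gcongr
    exact_mod_cast (card_le_card hP₀).trans card_le_two
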